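/- Let $\sigma$ be a smooth, strictly convex, closed curve in $\mathbb R^2$, that is, a smooth regular closed curve, not necessarily of constant speed, whose unit tangent map from the parameter circle to the unit circle $\mathbb S^1$ is a diffeomorphism of degree one (in particular, $\sigma$ is traversed counterclockwise and its curvature is positive). Let $L$ be its length, $s$ its arc length parameter, $\kappa>0$ its curvature, and $\nabla\kappa=d\kappa/ds$. Set $$\mathcal E_G[\sigma]=\int_\sigma \frac{|\nabla\kappa|^2}{4\kappa^3}-\frac{(2\pi)^2}{L^2}\frac1\kappa\,ds+2\pi,\qquad \mathcal E_G^*[\sigma]=\int_\sigma \frac{|\nabla\kappa|^2}{4\kappa^2}-\kappa^2\,ds+\frac{(2\pi)^2}{L}.$$ Let $T_\sigma:\mathbb S^1\to\mathbb S^1$ be the unit tangent map of the constant-speed parametrization of $\sigma$ by $\mathbb S^1$, so that $T_\sigma(\cos\frac{2\pi s}{L},\sin\frac{2\pi s}{L})$ is the unit tangent vector at the point with arc length parameter $s$. Let $T_0(\cos\theta,\sin\theta)=(-\sin\theta,\cos\theta)$. The family $\mathcal O$ of Benguria–Loss ovals consists of those $\sigma$ for which the diffeomorphism $\phi_\sigma=T_0^{-1}\circ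 T_\sigma$ of $\mathbb S^1$ has the form $X\mapsto AX/|AX|$ for some $A\in \mathrm{SL}(2,\mathbb R)$. Then: 1. $\mathcal E_G[\sigma]\ge 0$, and $\mathcal E_G[\sigma]=0$ if and only if $\sigma\in\mathcal O$. 2. $\mathcal E_G^*[\sigma]\ge 0$, and $\mathcal E_G^*[\sigma]=0$ if and only if $\sigma\in\mathcal O$. -/

import Mathlib

open scoped ContDiff

noncomputable section

/-- The Euclidean plane `ℝ²`. -/
abbrev Plane : Type := EuclideanSpace ℝ (Fin 2)

/-- A smooth closed plane curve: a smooth immersion of the circle `ℝ / 2πℤ` into `ℝ²`, written as a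
`2π`-periodic map on `ℝ`. The parametrization need not have constant speed. -/
structure SmoothClosedCurve where
  toFun : ℝ → Plane
  smooth : ContDiff ℝ ∞ toFun
  periodic : Function.Periodic toFun (2 * Real.pi)
  immersion : ∀ t, deriv toFun t ≠ 0

namespace SmoothClosedCurve

/-- `|σ'(t)|`; the length element is `ds = |σ'(t)| dt`. -/
def speed (σ : SmoothClosedCurve) (t : ℝ) : ℝ := ‖deriv σ.toFun t‖

/-- The unit tangent vector `σ'(t) / |σ'(t)|`. -/
def unitTangent (σ : SmoothClosedCurve) (t : ℝ) : Plane :=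
  (σ.speed t)⁻¹ • deriv σ.toFun t

/-- Arc length from the base point `σ(0)`. -/
def arcLength (σ : SmoothClosedCurve) (t : ℝ) : ℝ := ∫ u in (0 : ℝ)..t, σ.speed u

/-- The length `L(σ)`. -/
def length (σ : SmoothClosedCurve) : ℝ := σ.arcLength (2 * Real.pi)

/-- The (signed) geodesic curvature `(x' y'' - y' x'') / |σ'|³`. -/
def curvature (σ : SmoothClosedCurve) (t : ℝ) : ℝ :=
  (deriv σ.toFun t 0 * deriv (deriv σ.toFun) t 1
    - deriv σ.toFun t 1 * deriv (deriv σ.toFun) t 0) / σ.speed t ^ 3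

/-- The intrinsic gradient of a function along the curve: its derivative with respect to
arc length. -/
def grad (σ : SmoothClosedCurve) (f : ℝ → ℝ) (t : ℝ) : ℝ := deriv f t / σ.speed t

/-- The integral `∫_σ f ds` over one period. -/
def integral (σ : SmoothClosedCurve) (f : ℝ → ℝ) : ℝ :=
  ∫ t in (0 : ℝ)..(2 * Real.pi), f t * σ.speed t

/-- The curve is strictly convex: its unit tangent map, as a map from the parameter circle
`ℝ / 2πℤ` to the unit circle, has degree one and is a diffeomorphism. This is expressed by a
lift `ϑ : ℝ → ℝ` (tangent angle) that is smooth with smooth inverse and satisfies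
`ϑ (t + 2π) = ϑ t + 2π`. -/
def StrictlyConvex (σ : SmoothClosedCurve) : Prop :=
  ∃ ϑ η : ℝ → ℝ, ContDiff ℝ ∞ ϑ ∧ ContDiff ℝ ∞ η ∧
    Function.LeftInverse η ϑ ∧ Function.RightInverse η ϑ ∧
    (∀ t, ϑ (t + 2 * Real.pi) = ϑ t + 2 * Real.pi) ∧
    ∀ t, σ.unitTangent t = !₂[Real.cos (ϑ t), Real.sin (ϑ t)]

/-- `𝓔_G[σ] = ∫_σ |∇κ|² / (4 κ³) - ((2π)² / L²) (1 / κ) ds + 2π`. -/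
def energyG (σ : SmoothClosedCurve) : ℝ :=
  σ.integral (fun t => (σ.grad σ.curvature t) ^ 2 / (4 * σ.curvature t ^ 3)
    - (2 * Real.pi) ^ 2 / σ.length ^ 2 * (1 / σ.curvature t)) + 2 * Real.pi

/-- `𝓔_G^*[σ] = ∫_σ |∇κ|² / (4 κ²) - κ² ds + (2π)² / L`. -/
def energyGStar (σ : SmoothClosedCurve) : ℝ :=
  σ.integral (fun t => (σ.grad σ.curvature t) ^ 2 / (4 * σ.curvature t ^ 2)
    - σ.curvature t ^ 2) + (2 * Real.pi) ^ 2 / σ.length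

end SmoothClosedCurve

/-- The covering map `ℝ → 𝕊¹ ⊂ ℝ²`. -/
def circlePoint (x : ℝ) : Plane := !₂[Real.cos x, Real.sin x]

/-- The unit tangent map of the standard counterclockwise unit circle:
`(cos θ, sin θ) ↦ (-sin θ, cos θ)`. -/
def standardTangent (p : Plane) : Plane := !₂[-(p 1), p 0]

/-- The Möbius transformation `X ↦ A X / |A X|` of `𝕊¹` given by `A ∈ SL(2, ℝ)`. -/
def moebius (A : Matrix.SpecialLinearGroup (Fin 2) ℝ) (p : Plane) : Plane :=
  ‖Matrix.toEuclideanLin A.1 p‖⁻¹ • Matrix.toEuclideanLin A.1 p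

/-- The Benguria–Loss ovals `𝓞`: strictly convex curves whose induced diffeomorphism
`φ_σ` of `𝕊¹` is a Möbius transformation. Here `φ_σ` is determined by
`T_σ = standardTangent ∘ φ_σ`, where `T_σ : 𝕊¹ → 𝕊¹` is the unit tangent map of the
constant-speed parametrization of the curve by `𝕊¹`: the point `σ(t)` has the constant-speed
parameter `2π s(t) / L`, with `s` the arc length from `σ(0)`. -/
def SmoothClosedCurve.IsOval (σ : SmoothClosedCurve) : Prop :=
  σ.StrictlyConvex ∧ ∃ A : Matrix.SpecialLinearGroup (Fin 2) ℝ, ∀ t : ℝ,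
    σ.unitTangent t =
      standardTangent (moebius A (circlePoint (2 * Real.pi * σ.arcLength t / σ.length)))

end

/-!
Both energies are, up to a positive factor, of the form `∫ (g''² / (4 g'³) - 1 / g') + 2π` for a
lift `g : ℝ → ℝ` of a circle diffeomorphism: for `𝓔_G` it is the tangent angle as a function of the
normalized arc length, for `𝓔_G^*` the inverse of that function. In terms of `X = cos g / √g'` and
`Y = sin g / √g'` the energy becomes `∫ (X'² - X²) + ∫ (Y'² - Y²)`, and both integrals are
nonnegative by Wirtinger's inequality once `X` and `Y` each take opposite values at some pair of
antipodal points.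

Such a pair comes from the closing-up condition `∫ exp (i g) = 0`. If `X y + X (y + π) > 0` for all
`y`, the derivative of `g (y + π) - π - g y` at its zeros has the sign of `cos g`; this forces the
function to be positive between some zero `p` and its antipode `p + π`, which contradicts
`∫ cos (g - g p) = 0`. The existence of such a `p` passes from the inverse of `g` to `g`, so the
same contradiction serves both energies; the same goes for `Y`. In the case of equality `X` and `Y`
are linear combinations of `cos` and `sin`, which says precisely that `g` is a Möbius transformation
of the circle.
-/

open Real Set Filter Topology

/-! ### Preliminaries on derivatives -/

section Deriv

variable {E : Type*} [NormedAddCommGroup E] [NormedSpace ℝ E]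

lemma periodic_deriv {f : ℝ → E} {c : ℝ} (hf : Function.Periodic f c) :
    Function.Periodic (deriv f) c :=
  fun y => by rw [← deriv_comp_add_const, funext hf]

lemma deriv_eq_of_eqOn_Icc {f g : ℝ → E} {a b y : ℝ} (hab : a < b) (hy : y ∈ Icc a b)
    (hf : DifferentiableAt ℝ f y) (hg : DifferentiableAt ℝ g y) (h : EqOn f g (Icc a b)) :
    deriv f y = deriv g y := by
  have huniq := uniqueDiffOn_Icc hab y hy
  rw [← hf.derivWithin huniq, ← hg.derivWithin huniq, derivWithin_congr h (h hy)]

lemma hasDerivAt_euclideanSpace_apply {ι : Type*} [Fintype ι] {f : ℝ → EuclideanSpace ℝ ι}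
    {f' : EuclideanSpace ℝ ι} {t : ℝ} (hf : HasDerivAt f f' t) (i : ι) :
    HasDerivAt (fun t => f t i) (f' i) t :=
  (EuclideanSpace.proj (𝕜 := ℝ) i).hasFDerivAt.comp_hasDerivAt t hf

lemma continuousAt_sq_div_of_eq_zero {𝕜 : Type*} [NontriviallyNormedField 𝕜] {f s : 𝕜 → 𝕜}
    {s' b : 𝕜} (hf : DifferentiableAt 𝕜 f b) (hfb : f b = 0) (hs : HasDerivAt s s' b)
    (hsb : s b = 0) (hs' : s' ≠ 0) : ContinuousAt (fun y => f y ^ 2 / s y) b := by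
  have hfactor : (fun y => f y ^ 2 / s y) = fun y => f y * (dslope f b y / dslope s b y) := by
    funext y
    rcases eq_or_ne y b with rfl | hy
    · simp [hfb]
    · rw [dslope_of_ne _ hy, dslope_of_ne _ hy, slope_def_field, slope_def_field, hfb, hsb,
        sub_zero, sub_zero, div_div_div_cancel_right₀ (sub_ne_zero.2 hy)]
      ring
  rw [hfactor]
  refine hf.continuousAt.mul ((continuousAt_dslope_same.2 hf).div
    (continuousAt_dslope_same.2 hs.differentiableAt) ?_)
  rwa [dslope_same, hs.deriv]

end Deriv

/-! ### Sign of a function from its derivative at the zeros -/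

lemma pos_right_of_deriv_pos_of_eq_zero {f : ℝ → ℝ} (hf : Differentiable ℝ f) {a b : ℝ}
    (hab : a < b) (ha : 0 ≤ f a) (hpos : ∀ x ∈ Icc a b, f x = 0 → 0 < deriv f x) : 0 < f b := by
  have hnonneg : ∀ x ∈ Icc a b, 0 ≤ f x :=
    image_le_of_deriv_right_lt_deriv_boundary (f := fun _ => 0) continuousOn_const
      (fun _ _ => hasDerivWithinAt_const _ _ _) ha (fun x => (hf x).hasDerivAt)
      fun x hx h0 => hpos x (Ico_subset_Icc_self hx) h0.symm
  refine (hnonneg b (right_mem_Icc.2 hab.le)).lt_of_ne' fun hb => ?_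
  have hsign : ∀ᶠ x in 𝓝[<] b, SignType.sign (f x) = SignType.sign (x - b) :=
    (eventually_nhdsWithin_sign_eq_of_deriv_pos (hpos b (right_mem_Icc.2 hab.le) hb) hb).filter_mono
      nhdsWithin_le_nhds
  obtain ⟨x, hx, hax, hxb⟩ := (hsign.and (Ioo_mem_nhdsLT hab)).exists
  rw [sign_neg (sub_neg.2 hxb), sign_eq_neg_one_iff] at hx
  exact hx.not_ge (hnonneg x ⟨hax.le, hxb.le⟩)

lemma pos_left_of_deriv_neg_of_eq_zero {f : ℝ → ℝ} (hf : Differentiable ℝ f) {a b : ℝ}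
    (hab : a < b) (hb : 0 ≤ f b) (hneg : ∀ x ∈ Icc a b, f x = 0 → deriv f x < 0) : 0 < f a := by
  have := pos_right_of_deriv_pos_of_eq_zero (f := fun x => f (-x)) (hf.comp differentiable_neg)
    (neg_lt_neg hab) (by simpa using hb) fun x hx h0 => by
      rw [deriv_comp_neg, neg_pos]
      exact hneg (-x) ⟨le_neg.1 hx.2, neg_le.1 hx.1⟩ h0
  simpa using this

/-! ### Wirtinger's inequality for functions with an antipodal zero -/

section Wirtinger

/-- The defect `∫ₐᵇ (f'² - f²)` in Wirtinger's inequality. -/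
noncomputable def wirtingerDefect (f : ℝ → ℝ) (a b : ℝ) : ℝ :=
  ∫ y in a..b, (deriv f y ^ 2 - f y ^ 2)

/-- The primitive of `(f' - f cot(· - a))²` given by Picone's identity. At `a` and `a + π` the
subtracted term is a division by zero, with value `0`; this is its limit if `f` vanishes there. -/
noncomputable def piconePrimitive (f : ℝ → ℝ) (a y : ℝ) : ℝ :=
  wirtingerDefect f a y - f y ^ 2 / sin (y - a) * cos (y - a)

variable {f : ℝ → ℝ} {a : ℝ}

lemma continuous_deriv_sq_sub_sq (hf : ContDiff ℝ 1 f) :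
    Continuous fun y => deriv f y ^ 2 - f y ^ 2 :=
  (hf.continuous_deriv_one.pow 2).sub (hf.continuous.pow 2)

lemma wirtingerDefect_add_adjacent (hf : ContDiff ℝ 1 f) (a b c : ℝ) :
    wirtingerDefect f a b + wirtingerDefect f b c = wirtingerDefect f a c :=
  intervalIntegral.integral_add_adjacent_intervals
    ((continuous_deriv_sq_sub_sq hf).intervalIntegrable _ _)
    ((continuous_deriv_sq_sub_sq hf).intervalIntegrable _ _)

lemma hasDerivAt_wirtingerDefect (hf : ContDiff ℝ 1 f) (a y : ℝ) :
    HasDerivAt (wirtingerDefect f a) (deriv f y ^ 2 - f y ^ 2) y :=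
  ((continuous_deriv_sq_sub_sq hf).integral_hasStrictDerivAt a y).hasDerivAt

lemma piconePrimitive_left : piconePrimitive f a a = 0 := by
  simp [piconePrimitive, wirtingerDefect]

lemma piconePrimitive_right : piconePrimitive f a (a + π) = wirtingerDefect f a (a + π) := by
  simp [piconePrimitive]

lemma hasDerivAt_piconePrimitive (hf : ContDiff ℝ 1 f) {y : ℝ} (hy : sin (y - a) ≠ 0) :
    HasDerivAt (piconePrimitive f a) ((deriv f y - f y * cos (y - a) / sin (y - a)) ^ 2) y := by
  have hsin := (hasDerivAt_sin (y - a)).comp_sub_const y a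
  have hcos := (hasDerivAt_cos (y - a)).comp_sub_const y a
  have hfy := (hf.differentiable_one y).hasDerivAt
  refine ((hasDerivAt_wirtingerDefect hf a y).sub
    (((hfy.pow 2).div hsin hy).mul hcos)).congr_deriv ?_
  simp only [Pi.pow_apply, Pi.div_apply]
  field_simp
  ring

lemma sin_sub_pos_of_mem_Ioo {y : ℝ} (hy : y ∈ Ioo a (a + π)) : 0 < sin (y - a) :=
  sin_pos_of_pos_of_lt_pi (sub_pos.2 hy.1) (sub_lt_iff_lt_add'.2 hy.2)

lemma continuousOn_piconePrimitive (hf : ContDiff ℝ 1 f) (ha : f a = 0) (hb : f (a + π) = 0) :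
    ContinuousOn (piconePrimitive f a) (Icc a (a + π)) := by
  have hzero : ∀ z, f z = 0 → sin (z - a) = 0 → cos (z - a) ≠ 0 →
      ContinuousAt (piconePrimitive f a) z := fun z hfz hsz hcz =>
    (hasDerivAt_wirtingerDefect hf a z).continuousAt.sub
      ((continuousAt_sq_div_of_eq_zero (hf.differentiable_one z) hfz
        ((hasDerivAt_sin (z - a)).comp_sub_const z a) hsz hcz).mul (by fun_prop))
  intro y hy
  refine ContinuousAt.continuousWithinAt ?_
  rcases eq_endpoints_or_mem_Ioo_of_mem_Icc hy with rfl | rfl | hy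
  · exact hzero y ha (by simp) (by simp)
  · exact hzero _ hb (by simp) (by simp)
  · exact (hasDerivAt_piconePrimitive hf (sin_sub_pos_of_mem_Ioo hy).ne').continuousAt

lemma monotoneOn_piconePrimitive (hf : ContDiff ℝ 1 f) (ha : f a = 0) (hb : f (a + π) = 0) :
    MonotoneOn (piconePrimitive f a) (Icc a (a + π)) := by
  have hderiv : ∀ y ∈ Ioo a (a + π), HasDerivAt (piconePrimitive f a) _ y := fun y hy =>
    hasDerivAt_piconePrimitive hf (sin_sub_pos_of_mem_Ioo hy).ne'
  refine monotoneOn_of_deriv_nonneg (convex_Icc _ _) (continuousOn_piconePrimitive hf ha hb) ?_ ?_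
  all_goals rw [interior_Icc]
  · exact fun y hy => (hderiv y hy).differentiableAt.differentiableWithinAt
  · exact fun y hy => (hderiv y hy).deriv ▸ sq_nonneg _

lemma wirtingerDefect_nonneg_of_eq_zero (hf : ContDiff ℝ 1 f) (ha : f a = 0)
    (hb : f (a + π) = 0) : 0 ≤ wirtingerDefect f a (a + π) := by
  have hab : a ≤ a + π := le_add_of_nonneg_right pi_pos.le
  simpa only [piconePrimitive_left, piconePrimitive_right] using
    monotoneOn_piconePrimitive hf ha hb (left_mem_Icc.2 hab) (right_mem_Icc.2 hab) hab

lemma deriv_mul_sin_eq_of_wirtingerDefect_eq_zero (hf : ContDiff ℝ 1 f) (ha : f a = 0)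
    (hb : f (a + π) = 0) (h : wirtingerDefect f a (a + π) = 0) :
    ∀ y ∈ Ioo a (a + π), deriv f y * sin (y - a) = f y * cos (y - a) := by
  intro y hy
  have hab : a ≤ a + π := le_add_of_nonneg_right pi_pos.le
  have hmono := monotoneOn_piconePrimitive hf ha hb
  have hconst : piconePrimitive f a =ᶠ[𝓝 y] fun _ => 0 := by
    filter_upwards [Icc_mem_nhds hy.1 hy.2] with x hx
    refine le_antisymm ?_ ?_
    · simpa only [piconePrimitive_right, h] using hmono hx (right_mem_Icc.2 hab) hx.2
    · simpa only [piconePrimitive_left] using hmono (left_mem_Icc.2 hab) hx hx.1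
  have hsin := (sin_sub_pos_of_mem_Ioo hy).ne'
  have hsq := (hasDerivAt_piconePrimitive hf hsin).unique
    ((hasDerivAt_const y (0 : ℝ)).congr_of_eventuallyEq hconst)
  exact (eq_div_iff hsin).1 (sub_eq_zero.1 (pow_eq_zero_iff two_ne_zero |>.1 hsq))

lemma eq_mul_sin_of_wirtingerDefect_eq_zero (hf : ContDiff ℝ 1 f) (ha : f a = 0)
    (hb : f (a + π) = 0) (h : wirtingerDefect f a (a + π) = 0) :
    ∀ y ∈ Icc a (a + π), f y = f (a + π / 2) * sin (y - a) := by
  have hode := deriv_mul_sin_eq_of_wirtingerDefect_eq_zero hf ha hb h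
  have hderiv : ∀ y ∈ Ioo a (a + π), HasDerivAt (fun y => f y / sin (y - a)) 0 y := by
    intro y hy
    refine ((hf.differentiable_one y).hasDerivAt.div
      ((hasDerivAt_sin (y - a)).comp_sub_const y a)
      (sin_sub_pos_of_mem_Ioo hy).ne').congr_deriv ?_
    rw [hode y hy, sub_self, zero_div]
  intro y hy
  rcases eq_endpoints_or_mem_Ioo_of_mem_Icc hy with rfl | rfl | hy
  · simp [ha]
  · simp [hb]
  have hmid : a + π / 2 ∈ Ioo a (a + π) := by constructor <;> linarith [pi_pos]
  have hquot := isOpen_Ioo.is_const_of_deriv_eq_zero isPreconnected_Ioo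
    (fun x hx => (hderiv x hx).differentiableAt.differentiableWithinAt)
    (fun x hx => (hderiv x hx).deriv) hy hmid
  simp only [add_sub_cancel_left, sin_pi_div_two, div_one] at hquot
  exact (div_eq_iff (sin_sub_pos_of_mem_Ioo hy).ne').1 hquot

lemma wirtingerDefect_sub_mul_cos (hf : ContDiff ℝ 1 f) (k : ℝ) :
    wirtingerDefect (fun y => f y - k * cos (y - a)) a (a + π) = wirtingerDefect f a (a + π) := by
  have hcos : ContDiff ℝ 1 fun y => k * cos (y - a) := by fun_prop
  have hprim : ∀ y, HasDerivAt
      (fun y => 2 * k * f y * sin (y - a) - k ^ 2 * (sin (y - a) * cos (y - a)))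
      ((deriv (fun y => f y - k * cos (y - a)) y ^ 2 - (f y - k * cos (y - a)) ^ 2)
        - (deriv f y ^ 2 - f y ^ 2)) y := by
    intro y
    have hfy := (hf.differentiable_one y).hasDerivAt
    have hsin := (hasDerivAt_sin (y - a)).comp_sub_const y a
    have hcosy := (hasDerivAt_cos (y - a)).comp_sub_const y a
    refine (((hfy.const_mul (2 * k)).mul hsin).sub
      ((hsin.mul hcosy).const_mul (k ^ 2))).congr_deriv ?_
    rw [(hfy.fun_sub (hcosy.const_mul k)).deriv]
    ring
  have hcont := continuous_deriv_sq_sub_sq (hf.sub hcos)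
  rw [← sub_eq_zero, wirtingerDefect, wirtingerDefect, ← intervalIntegral.integral_sub
    (hcont.intervalIntegrable _ _) ((continuous_deriv_sq_sub_sq hf).intervalIntegrable _ _),
    intervalIntegral.integral_eq_sub_of_hasDerivAt (fun y _ => hprim y)
      ((hcont.sub (continuous_deriv_sq_sub_sq hf)).intervalIntegrable _ _)]
  simp

lemma wirtingerDefect_nonneg_of_eq_neg (hf : ContDiff ℝ 1 f) (ha : f (a + π) = -f a) :
    0 ≤ wirtingerDefect f a (a + π) := by
  rw [← wirtingerDefect_sub_mul_cos hf (f a)]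
  exact wirtingerDefect_nonneg_of_eq_zero (by fun_prop) (by simp) (by simp [ha])

lemma eq_cos_add_sin_of_wirtingerDefect_eq_zero (hf : ContDiff ℝ 1 f) (ha : f (a + π) = -f a)
    (h : wirtingerDefect f a (a + π) = 0) :
    ∀ y ∈ Icc a (a + π), f y = f a * cos (y - a) + f (a + π / 2) * sin (y - a) := by
  rw [← wirtingerDefect_sub_mul_cos hf (f a)] at h
  intro y hy
  have hsin := eq_mul_sin_of_wirtingerDefect_eq_zero (by fun_prop) (by simp) (by simp [ha]) h y hy
  simp only [add_sub_cancel_left, cos_pi_div_two, mul_zero, sub_zero] at hsin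
  linarith

lemma hasDerivAt_cos_add_sin (c d a y : ℝ) :
    HasDerivAt (fun y => c * cos (y - a) + d * sin (y - a))
      (d * cos (y - a) - c * sin (y - a)) y := by
  refine ((((hasDerivAt_cos (y - a)).comp_sub_const y a).const_mul c).add
    (((hasDerivAt_sin (y - a)).comp_sub_const y a).const_mul d)).congr_deriv ?_
  ring

lemma wirtingerDefect_eq_add_of_periodic (hf : ContDiff ℝ 1 f)
    (hper : Function.Periodic f (2 * π)) (a : ℝ) :
    wirtingerDefect f 0 (2 * π) =
      wirtingerDefect f a (a + π) + wirtingerDefect f (a + π) (a + π + π) := by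
  have hper' : Function.Periodic (fun y => deriv f y ^ 2 - f y ^ 2) (2 * π) := fun y => by
    simp only [hper y, periodic_deriv hper y]
  rw [wirtingerDefect_add_adjacent hf, add_assoc, ← two_mul]
  simpa only [wirtingerDefect, zero_add] using hper'.intervalIntegral_add_eq 0 a

lemma wirtingerDefect_nonneg_of_periodic (hf : ContDiff ℝ 1 f)
    (hper : Function.Periodic f (2 * π)) (ha : f (a + π) = -f a) :
    0 ≤ wirtingerDefect f 0 (2 * π) := by
  have ha' : f (a + π + π) = -f (a + π) := by rw [add_assoc, ← two_mul, hper, ha, neg_neg]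
  rw [wirtingerDefect_eq_add_of_periodic hf hper a]
  exact add_nonneg (wirtingerDefect_nonneg_of_eq_neg hf ha)
    (wirtingerDefect_nonneg_of_eq_neg hf ha')

lemma eq_cos_add_sin_of_periodic (hf : ContDiff ℝ 1 f) (hper : Function.Periodic f (2 * π))
    (ha : f (a + π) = -f a) (h : wirtingerDefect f 0 (2 * π) = 0) (y : ℝ) :
    f y = f a * cos (y - a) + f (a + π / 2) * sin (y - a) := by
  have hlt : ∀ b : ℝ, b < b + π := fun b => lt_add_of_pos_right b pi_pos
  have ha' : f (a + π + π) = -f (a + π) := by rw [add_assoc, ← two_mul, hper, ha, neg_neg]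
  rw [wirtingerDefect_eq_add_of_periodic hf hper a, add_eq_zero_iff_of_nonneg
    (wirtingerDefect_nonneg_of_eq_neg hf ha) (wirtingerDefect_nonneg_of_eq_neg hf ha')] at h
  have hfst := eq_cos_add_sin_of_wirtingerDefect_eq_zero hf ha h.1
  have hsnd := eq_cos_add_sin_of_wirtingerDefect_eq_zero hf ha' h.2
  have hmid : -f (a + π / 2) = f (a + π + π / 2) := by
    have hdiff := hf.differentiable_one (a + π)
    have hleft := deriv_eq_of_eqOn_Icc (hlt a) (right_mem_Icc.2 (hlt a).le) hdiff
      (hasDerivAt_cos_add_sin _ _ a _).differentiableAt hfst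
    have hright := deriv_eq_of_eqOn_Icc (hlt _) (left_mem_Icc.2 (hlt _).le) hdiff
      (hasDerivAt_cos_add_sin _ _ (a + π) _).differentiableAt hsnd
    rw [(hasDerivAt_cos_add_sin _ _ _ _).deriv] at hleft hright
    simpa using hleft.symm.trans hright
  have hperiod : ∀ y ∈ Ico a (a + 2 * π),
      f y = f a * cos (y - a) + f (a + π / 2) * sin (y - a) := by
    intro y hy
    rcases le_total y (a + π) with hya | hya
    · exact hfst y ⟨hy.1, hya⟩
    · rw [hsnd y ⟨hya, by linarith [hy.2]⟩, ← hmid, ha, ← sub_sub, cos_sub_pi, sin_sub_pi,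
        neg_mul_neg, neg_mul_neg]
  have hper' : Function.Periodic
      (fun y => f y - (f a * cos (y - a) + f (a + π / 2) * sin (y - a))) (2 * π) := fun y => by
    simp only [hper y, add_sub_right_comm y, cos_add_two_pi, sin_add_two_pi]
  obtain ⟨x, hx, hxy⟩ := hper'.exists_mem_Ico two_pi_pos y a
  rw [← sub_eq_zero, hxy, hperiod x hx, sub_self]

lemma wirtingerDefect_cos_add_sin (c d a : ℝ) :
    wirtingerDefect (fun y => c * cos (y - a) + d * sin (y - a)) 0 (2 * π) = 0 := by
  have hprim : ∀ y, HasDerivAt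
      (fun y => (c * cos (y - a) + d * sin (y - a)) * (d * cos (y - a) - c * sin (y - a)))
      ((d * cos (y - a) - c * sin (y - a)) ^ 2 - (c * cos (y - a) + d * sin (y - a)) ^ 2) y := by
    intro y
    refine ((hasDerivAt_cos_add_sin c d a y).mul
      ((hasDerivAt_cos_add_sin d (-c) a y).congr_of_eventuallyEq ?_)).congr_deriv ?_
    · exact .of_forall fun y => by ring
    · ring
  simp only [wirtingerDefect, (hasDerivAt_cos_add_sin c d a _).deriv]
  rw [intervalIntegral.integral_eq_sub_of_hasDerivAt (fun y _ => hprim y)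
    (Continuous.intervalIntegrable (by fun_prop) _ _)]
  simp only [show 2 * π - a = 0 - a + 2 * π by ring, cos_add_two_pi, sin_add_two_pi, sub_self]

end Wirtinger

/-! ### Lifts of circle diffeomorphisms -/

/-- A smooth lift to `ℝ` of an orientation preserving diffeomorphism of the circle `ℝ / 2πℤ`; the
tangent angle of a strictly convex curve and its normalized arc length are of this kind. -/
structure IsCircleLift (g : ℝ → ℝ) : Prop where
  smooth : ContDiff ℝ ∞ g
  deriv_pos : ∀ y, 0 < deriv g y
  add_two_pi : ∀ y, g (y + 2 * π) = g y + 2 * π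

namespace IsCircleLift

variable {g h : ℝ → ℝ}

lemma differentiable (hg : IsCircleLift g) : Differentiable ℝ g :=
  hg.smooth.differentiable (by simp)

lemma continuous (hg : IsCircleLift g) : Continuous g := hg.smooth.continuous

lemma strictMono (hg : IsCircleLift g) : StrictMono g := strictMono_of_deriv_pos hg.deriv_pos

lemma smooth_deriv (hg : IsCircleLift g) : ContDiff ℝ ∞ (deriv g) :=
  (contDiff_infty_iff_deriv.1 hg.smooth).2

lemma differentiable_deriv (hg : IsCircleLift g) : Differentiable ℝ (deriv g) :=
  hg.smooth_deriv.differentiable (by simp)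

lemma continuous_deriv (hg : IsCircleLift g) : Continuous (deriv g) := hg.smooth_deriv.continuous

lemma continuous_deriv_deriv (hg : IsCircleLift g) : Continuous (deriv (deriv g)) :=
  hg.smooth_deriv.continuous_deriv (by simp)

lemma periodic_deriv (hg : IsCircleLift g) : Function.Periodic (deriv g) (2 * π) := fun y => by
  rw [← deriv_comp_add_const, funext hg.add_two_pi, deriv_add_const]

lemma add_pi_add_pi (hg : IsCircleLift g) (y : ℝ) : g (y + π + π) = g y + 2 * π := by
  rw [add_assoc, ← two_mul, hg.add_two_pi]

lemma periodic_comp (hg : IsCircleLift g) {f : ℝ → ℝ} (hf : Function.Periodic f (2 * π)) :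
    Function.Periodic (f ∘ g) (2 * π) := fun y => by
  rw [Function.comp_apply, hg.add_two_pi, hf, Function.comp_apply]

lemma comp (hg : IsCircleLift g) (hh : IsCircleLift h) : IsCircleLift (g ∘ h) where
  smooth := hg.smooth.comp hh.smooth
  deriv_pos y := by
    rw [deriv_comp y (hg.differentiable _) (hh.differentiable y)]
    exact mul_pos (hg.deriv_pos _) (hh.deriv_pos y)
  add_two_pi y := by simp only [Function.comp, hh.add_two_pi, hg.add_two_pi]

lemma of_rightInverse (hg : IsCircleLift g) (hh : ContDiff ℝ ∞ h)
    (hr : Function.RightInverse h g) : IsCircleLift h where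
  smooth := hh
  deriv_pos y := by
    have hprod : deriv g (h y) * deriv h y = 1 := by
      rw [← deriv_comp y (hg.differentiable _) (hh.differentiable (by simp) y), hr.comp_eq_id,
        deriv_id]
    exact pos_of_mul_pos_right (hprod ▸ one_pos) (hg.deriv_pos _).le
  add_two_pi y := hg.strictMono.injective (by rw [hr, hg.add_two_pi, hr])

lemma surjective (hg : IsCircleLift g) : Function.Surjective g := by
  have hper : Function.Periodic (fun y => g y - y) (2 * π) := fun y => by
    simp only [hg.add_two_pi, add_sub_add_right_eq_sub]
  obtain ⟨C, hC⟩ := isBounded_iff_forall_norm_le.1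
    (hper.isBounded_of_continuous two_pi_pos.ne' (hg.continuous.sub continuous_id))
  have hbound : ∀ y, |g y - y| ≤ C := fun y => hC _ ⟨y, rfl⟩
  exact fun y => mem_range_of_exists_le_of_exists_ge hg.continuous
    ⟨y - C, by linarith [abs_le.1 (hbound (y - C))]⟩
    ⟨y + C, by linarith [abs_le.1 (hbound (y + C))]⟩

lemma exists_inverse (hg : IsCircleLift g) :
    ∃ h, IsCircleLift h ∧ Function.LeftInverse h g ∧ Function.RightInverse h g := by
  let e : ℝ ≃ₜ ℝ := (hg.strictMono.orderIsoOfSurjective g hg.surjective).toHomeomorph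
  have hsmooth : ContDiff ℝ ∞ e.symm :=
    e.contDiff_symm_deriv (f' := deriv g) (fun y => (hg.deriv_pos y).ne')
      (fun y => (hg.differentiable y).hasDerivAt) hg.smooth
  exact ⟨e.symm, hg.of_rightInverse hsmooth e.apply_symm_apply, e.symm_apply_apply,
    e.apply_symm_apply⟩

lemma integral_comp_mul_deriv (hg : IsCircleLift g) {f : ℝ → ℝ} (hf : Continuous f)
    (hper : Function.Periodic f (2 * π)) :
    ∫ t in 0..2 * π, f (g t) * deriv g t = ∫ y in 0..2 * π, f y := by
  have hsubst := intervalIntegral.integral_comp_mul_deriv (a := 0) (b := 2 * π)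
    (fun x _ => (hg.differentiable x).hasDerivAt) hg.continuous_deriv.continuousOn hf
  simp only [Function.comp_apply] at hsubst
  rw [hsubst, ← zero_add (2 * π), hg.add_two_pi, hper.intervalIntegral_add_eq (g 0) 0]

end IsCircleLift

/-! ### Balanced lifts -/

/-- The amount by which a lift turns more than a half turn between `y` and its antipode `y + π`. -/
noncomputable def antipodalDefect (g : ℝ → ℝ) (y : ℝ) : ℝ := g (y + π) - π - g y

/-- A lift is balanced if no half circle between two antipodal points with antipodal images has
antipodal defect positive throughout its interior. This is the consequence of the closing-up
condition `∫ exp (i g) = 0` used for the energy bounds; unlike that condition it passes to the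
inverse. -/
def IsBalanced (g : ℝ → ℝ) : Prop :=
  ∀ p, antipodalDefect g p = 0 → ∃ y ∈ Ioo p (p + π), antipodalDefect g y ≤ 0

section Balanced

variable {g h : ℝ → ℝ}

lemma antipodalDefect_add_pi (hg : IsCircleLift g) (y : ℝ) :
    antipodalDefect g (y + π) = -antipodalDefect g y := by
  rw [antipodalDefect, antipodalDefect, hg.add_pi_add_pi]
  ring

lemma hasDerivAt_antipodalDefect (hg : Differentiable ℝ g) (y : ℝ) :
    HasDerivAt (antipodalDefect g) (deriv g (y + π) - deriv g y) y :=
  (((hg (y + π)).hasDerivAt.comp_add_const y π).sub_const π).sub (hg y).hasDerivAt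

lemma apply_add_pi_of_antipodalDefect_eq_zero {p : ℝ} (hp : antipodalDefect g p = 0) :
    g (p + π) = g p + π :=
  sub_eq_iff_eq_add.1 (sub_eq_zero.1 hp)

lemma exists_antipodalDefect_eq_zero (hg : IsCircleLift g) : ∃ p, antipodalDefect g p = 0 := by
  have hodd := antipodalDefect_add_pi hg 0
  have hcont : Continuous (antipodalDefect g) :=
    Differentiable.continuous fun y =>
      (hasDerivAt_antipodalDefect hg.differentiable y).differentiableAt
  rcases le_total (antipodalDefect g 0) 0 with h | h
  · exact mem_range_of_exists_le_of_exists_ge hcont ⟨0, h⟩ ⟨0 + π, by linarith⟩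
  · exact mem_range_of_exists_le_of_exists_ge hcont ⟨0 + π, by linarith⟩ ⟨0, h⟩

lemma IsBalanced.of_inverse (hb : IsBalanced g) (hg : IsCircleLift g) (hh : IsCircleLift h)
    (hl : Function.LeftInverse h g) (hr : Function.RightInverse h g) : IsBalanced h := by
  intro q hq
  have hgp : g (h q + π) = q + π := by
    rw [← apply_add_pi_of_antipodalDefect_eq_zero hq, hr]
  obtain ⟨x, hx, hdefect⟩ := hb (h q + π) (by
    rw [antipodalDefect_add_pi hg, antipodalDefect, hgp, hr, add_sub_cancel_right, sub_self,
      neg_zero])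
  obtain ⟨y, rfl⟩ : ∃ y, y + π = x := ⟨x - π, sub_add_cancel x π⟩
  rw [antipodalDefect_add_pi hg, neg_nonpos, antipodalDefect, sub_nonneg, le_sub_iff_add_le]
    at hdefect
  refine ⟨g y, ⟨?_, ?_⟩, ?_⟩
  · simpa only [hr q] using hg.strictMono (lt_of_add_lt_add_right hx.1)
  · simpa only [hgp] using hg.strictMono (lt_of_add_lt_add_right hx.2)
  · have := hh.strictMono.monotone hdefect
    rw [hl] at this
    rw [antipodalDefect, hl]
    linarith

lemma integral_cos_comp_sub_eq_zero (hg : Continuous g)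
    (hcos : ∫ y in 0..2 * π, cos (g y) = 0)
    (hsin : ∫ y in 0..2 * π, sin (g y) = 0) (c : ℝ) :
    ∫ y in 0..2 * π, cos (g y - c) = 0 := by
  simp_rw [cos_sub]
  rw [intervalIntegral.integral_add, intervalIntegral.integral_mul_const,
    intervalIntegral.integral_mul_const, hcos, hsin, zero_mul, zero_mul, add_zero]
  all_goals exact Continuous.intervalIntegrable (by fun_prop) _ _

lemma integral_half_period_add_antipodal {f : ℝ → ℝ} (hf : Continuous f)
    (hper : Function.Periodic f (2 * π)) (p : ℝ) :
    ∫ y in p..(p + π), (f y + f (y + π)) = ∫ y in 0..2 * π, f y := by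
  have hint : ∀ a b, IntervalIntegrable f MeasureTheory.volume a b := hf.intervalIntegrable
  rw [intervalIntegral.integral_add (hint _ _)
      (Continuous.intervalIntegrable (by fun_prop) _ _),
    intervalIntegral.integral_comp_add_right f π,
    intervalIntegral.integral_add_adjacent_intervals (hint _ _) (hint _ _), add_assoc, ← two_mul,
    hper.intervalIntegral_add_eq p 0, zero_add]

lemma isBalanced_of_integral_cos_sin (hg : IsCircleLift g)
    (hcos : ∫ y in 0..2 * π, cos (g y) = 0)
    (hsin : ∫ y in 0..2 * π, sin (g y) = 0) : IsBalanced g := by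
  intro p _
  by_contra! hpos
  have hcont : Continuous fun y => cos (g y - g p) :=
    continuous_cos.comp (hg.continuous.sub continuous_const)
  have hper : Function.Periodic (fun y => cos (g y - g p)) (2 * π) := fun y => by
    simp only [hg.add_two_pi, add_sub_right_comm, cos_add_two_pi]
  have hsum : Continuous fun y => cos (g y - g p) + cos (g (y + π) - g p) :=
    hcont.add (hcont.comp (continuous_add_const π))
  have hint := integral_half_period_add_antipodal hcont hper p
  rw [integral_cos_comp_sub_eq_zero hg.continuous hcos hsin] at hint
  refine (intervalIntegral.intervalIntegral_pos_of_pos_on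
    (hsum.intervalIntegrable _ _) (fun y hy => ?_) (lt_add_of_pos_right p pi_pos)).ne' hint
  have hdefect : 0 < g (y + π) - π - g y := hpos y hy
  have hlow : g p < g y := hg.strictMono hy.1
  have hhigh : g (y + π) < g p + 2 * π := by
    simpa only [hg.add_pi_add_pi] using hg.strictMono (add_lt_add_left hy.2 π)
  -- The antipodal value is `-cos (g (y + π) - g p - π)`, and `cos` decreases on `[0, π]`.
  have hlt := cos_lt_cos_of_nonneg_of_le_pi (x := g y - g p) (y := g (y + π) - g p - π)
    (by linarith) (by linarith) (by linarith)
  rw [cos_sub_pi] at hlt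
  linarith

end Balanced

/-! ### Half densities -/

/-- The pullback by a lift `g` of the function `f` on the circle as a density of weight `-1/2`.
The pullbacks of the linear functions `cos` and `sin` linearize the action of `SL(2, ℝ)`. -/
noncomputable def halfDensity (f g : ℝ → ℝ) (y : ℝ) : ℝ := f (g y) / √(deriv g y)

section HalfDensity

variable {f g : ℝ → ℝ}

lemma cos_nonneg_of_mem_Icc_of_lt_add_pi {a b x : ℝ} (hx : x ∈ Icc a b) (hab : b < a + π)
    (ha : 0 ≤ cos a) (hb : 0 ≤ cos b) : 0 ≤ cos x := by
  rcases hx.1.eq_or_lt with rfl | hax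
  · exact ha
  have hsin : 0 < sin (b - a) :=
    sin_pos_of_pos_of_lt_pi (sub_pos.2 (hax.trans_le hx.2)) (sub_lt_iff_lt_add'.2 hab)
  have hsina : 0 ≤ sin (x - a) :=
    sin_nonneg_of_nonneg_of_le_pi (sub_nonneg.2 hx.1) (by linarith [hx.2])
  have hsinb : 0 ≤ sin (b - x) :=
    sin_nonneg_of_nonneg_of_le_pi (sub_nonneg.2 hx.2) (by linarith [hx.1])
  refine nonneg_of_mul_nonneg_right (b := cos x) ?_ hsin
  calc 0 ≤ sin (b - x) * cos a + sin (x - a) * cos b := by positivity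
    _ = sin (b - a) * cos x := by
      simp only [sin_sub]
      ring

lemma contDiff_halfDensity (hg : IsCircleLift g) (hf : ContDiff ℝ ∞ f) :
    ContDiff ℝ ∞ (halfDensity f g) :=
  (hf.comp hg.smooth).div (hg.smooth_deriv.sqrt fun y => (hg.deriv_pos y).ne')
    fun y => (sqrt_pos.2 (hg.deriv_pos y)).ne'

lemma periodic_halfDensity (hg : IsCircleLift g) (hf : Function.Periodic f (2 * π)) :
    Function.Periodic (halfDensity f g) (2 * π) := fun y => by
  rw [halfDensity, halfDensity, hg.add_two_pi, hf, hg.periodic_deriv]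

lemma hasDerivAt_halfDensity (hg : IsCircleLift g) {f' y : ℝ} (hf : HasDerivAt f f' (g y)) :
    HasDerivAt (halfDensity f g) (f' * √(deriv g y)
      - f (g y) * deriv (deriv g) y / (2 * √(deriv g y) ^ 3)) y := by
  have hpos := hg.deriv_pos y
  have hsqrt : √(deriv g y) ≠ 0 := (sqrt_pos.2 hpos).ne'
  refine ((hf.comp y (hg.differentiable y).hasDerivAt).div
    ((hg.differentiable_deriv y).hasDerivAt.sqrt hpos.ne') hsqrt).congr_deriv ?_
  simp only [Function.comp_apply]
  nth_rewrite 1 [← sq_sqrt hpos.le]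
  field_simp

lemma halfDensity_cos_sub_add_antipodal {c p : ℝ}
    (hp : antipodalDefect g p = 0) :
    halfDensity (fun x => cos (x - c)) g p + halfDensity (fun x => cos (x - c)) g (p + π) =
      cos (g p - c) * (1 / √(deriv g p) - 1 / √(deriv g (p + π))) := by
  rw [halfDensity, halfDensity, apply_add_pi_of_antipodalDefect_eq_zero hp, add_sub_right_comm,
    cos_add_pi]
  ring

lemma cos_mul_deriv_antipodalDefect_pos (hg : IsCircleLift g) {c : ℝ}
    (h : ∀ y, 0 < halfDensity (fun x => cos (x - c)) g y
      + halfDensity (fun x => cos (x - c)) g (y + π)) {y : ℝ} (hy : antipodalDefect g y = 0) :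
    0 < cos (g y - c) * deriv (antipodalDefect g) y := by
  have hprod := h y
  rw [halfDensity_cos_sub_add_antipodal hy] at hprod
  rw [(hasDerivAt_antipodalDefect hg.differentiable y).deriv]
  have hsqrt : ∀ x, 0 < √(deriv g x) := fun x => sqrt_pos.2 (hg.deriv_pos x)
  rcases pos_and_pos_or_neg_and_neg_of_mul_pos hprod with ⟨hcos, hdiff⟩ | ⟨hcos, hdiff⟩
  · rw [sub_pos, one_div_lt_one_div (hsqrt _) (hsqrt _), sqrt_lt_sqrt_iff (hg.deriv_pos _).le]
      at hdiff
    exact mul_pos hcos (sub_pos.2 hdiff)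
  · rw [sub_neg, one_div_lt_one_div (hsqrt _) (hsqrt _), sqrt_lt_sqrt_iff (hg.deriv_pos _).le]
      at hdiff
    exact mul_pos_of_neg_of_neg hcos (sub_neg.2 hdiff)

lemma antipodalDefect_pos_of_cos_pos (hg : IsCircleLift g) {c p : ℝ}
    (h : ∀ y, antipodalDefect g y = 0 → 0 < cos (g y - c) * deriv (antipodalDefect g) y)
    (hp : antipodalDefect g p = 0) (hcos : 0 < cos (g p - c)) {z : ℝ} (hz : z ∈ Ioo p (p + π)) :
    0 < antipodalDefect g z := by
  have hdiff : Differentiable ℝ (antipodalDefect g) := fun y =>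
    (hasDerivAt_antipodalDefect hg.differentiable y).differentiableAt
  have hpz := hg.strictMono hz.1
  have hzp : g z < g p + π :=
    apply_add_pi_of_antipodalDefect_eq_zero hp ▸ hg.strictMono hz.2
  rcases le_total 0 (cos (g z - c)) with hcosz | hcosz
  · refine pos_right_of_deriv_pos_of_eq_zero hdiff hz.1 hp.ge fun x hx hx0 => ?_
    have hcosx : 0 ≤ cos (g x - c) := cos_nonneg_of_mem_Icc_of_lt_add_pi
      ⟨sub_le_sub_right (hg.strictMono.monotone hx.1) c,
        sub_le_sub_right (hg.strictMono.monotone hx.2) c⟩ (by linarith) hcos.le hcosz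
    exact pos_of_mul_pos_right (h x hx0) hcosx
  · refine pos_left_of_deriv_neg_of_eq_zero hdiff hz.2
      (by rw [antipodalDefect_add_pi hg, hp, neg_zero]) fun x hx hx0 => ?_
    have hxp : g x ≤ g p + π :=
      apply_add_pi_of_antipodalDefect_eq_zero hp ▸ hg.strictMono.monotone hx.2
    have hcosx : 0 ≤ cos (g x - c - π) := cos_nonneg_of_mem_Icc_of_lt_add_pi
      (a := g z - c - π) (b := g p - c)
      ⟨by linarith [hg.strictMono.monotone hx.1], by linarith⟩ (by linarith)
      (by rw [cos_sub_pi]; linarith) hcos.le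
    rw [cos_sub_pi, neg_nonneg] at hcosx
    exact neg_of_mul_pos_right (h x hx0) hcosx

lemma not_isBalanced_of_halfDensity_antipodal_pos (hg : IsCircleLift g) {c : ℝ}
    (h : ∀ y, 0 < halfDensity (fun x => cos (x - c)) g y
      + halfDensity (fun x => cos (x - c)) g (y + π)) : ¬ IsBalanced g := by
  have hpos := fun y hy => cos_mul_deriv_antipodalDefect_pos hg h (y := y) hy
  obtain ⟨p, hp, hcos⟩ : ∃ p, antipodalDefect g p = 0 ∧ 0 < cos (g p - c) := by
    obtain ⟨p, hp⟩ := exists_antipodalDefect_eq_zero hg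
    rcases (left_ne_zero_of_mul (hpos p hp).ne').lt_or_gt with hneg | hcos
    · refine ⟨p + π, by rw [antipodalDefect_add_pi hg, hp, neg_zero], ?_⟩
      rwa [apply_add_pi_of_antipodalDefect_eq_zero hp, add_sub_right_comm, cos_add_pi, neg_pos]
    · exact ⟨p, hp, hcos⟩
  intro hb
  obtain ⟨z, hz, hdefect⟩ := hb p hp
  exact hdefect.not_gt (antipodalDefect_pos_of_cos_pos hg hpos hp hcos hz)

lemma exists_halfDensity_cos_sub_antipodal (hg : IsCircleLift g) (hb : IsBalanced g) (c : ℝ) :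
    ∃ y, halfDensity (fun x => cos (x - c)) g (y + π) =
      -halfDensity (fun x => cos (x - c)) g y := by
  have hcont : Continuous (halfDensity (fun x => cos (x - c)) g) :=
    (contDiff_halfDensity hg (by fun_prop)).continuous
  have hle : ∀ c, ∃ y, halfDensity (fun x => cos (x - c)) g y
      + halfDensity (fun x => cos (x - c)) g (y + π) ≤ 0 := fun c => by
    by_contra! hpos
    exact not_isBalanced_of_halfDensity_antipodal_pos hg hpos hb
  have hge : ∃ y, 0 ≤ halfDensity (fun x => cos (x - c)) g y
      + halfDensity (fun x => cos (x - c)) g (y + π) := by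
    obtain ⟨y, hy⟩ := hle (c + π)
    refine ⟨y, ?_⟩
    simp only [halfDensity, ← sub_sub, cos_sub_pi, neg_div] at hy ⊢
    linarith
  obtain ⟨y, hy⟩ := mem_range_of_exists_le_of_exists_ge
    (hcont.add (hcont.comp (continuous_add_const π))) (hle c) hge
  exact ⟨y, eq_neg_of_add_eq_zero_right hy⟩

lemma wirtingerDefect_halfDensity_nonneg (hg : IsCircleLift g) (hb : IsBalanced g) (c : ℝ) :
    0 ≤ wirtingerDefect (halfDensity (fun x => cos (x - c)) g) 0 (2 * π) := by
  obtain ⟨y, hy⟩ := exists_halfDensity_cos_sub_antipodal hg hb c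
  exact wirtingerDefect_nonneg_of_periodic
    ((contDiff_halfDensity hg (by fun_prop)).of_le (by simp))
    (periodic_halfDensity hg fun x => by simp only [add_sub_right_comm, cos_add_two_pi]) hy

lemma halfDensity_eq_cos_add_sin (hg : IsCircleLift g) (hb : IsBalanced g) {c : ℝ}
    (h : wirtingerDefect (halfDensity (fun x => cos (x - c)) g) 0 (2 * π) = 0) :
    ∃ u v, ∀ y, halfDensity (fun x => cos (x - c)) g y = u * cos y + v * sin y := by
  obtain ⟨a, ha⟩ := exists_halfDensity_cos_sub_antipodal hg hb c
  have heq := eq_cos_add_sin_of_periodic ((contDiff_halfDensity hg (by fun_prop)).of_le (by simp))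
    (periodic_halfDensity hg fun x => by simp only [add_sub_right_comm, cos_add_two_pi]) ha h
  set X := halfDensity (fun x => cos (x - c)) g
  refine ⟨X a * cos a - X (a + π / 2) * sin a, X a * sin a + X (a + π / 2) * cos a, fun y => ?_⟩
  rw [heq y, cos_sub, sin_sub]
  ring

end HalfDensity

/-! ### The energy of a lift -/

/-- The density `g''² / (4 g'³) - 1 / g'` of the energy of a lift. -/
noncomputable def energyDensity (g : ℝ → ℝ) (y : ℝ) : ℝ :=
  deriv (deriv g) y ^ 2 / (4 * deriv g y ^ 3) - 1 / deriv g y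

/-- The common form of both energies on the circle: `𝓔_G` is the energy of the tangent angle as a
function of normalized arc length, `𝓔_G^*` that of the inverse function up to a factor. -/
noncomputable def liftEnergy (g : ℝ → ℝ) : ℝ :=
  (∫ y in 0..2 * π, energyDensity g y) + 2 * π

namespace IsCircleLift

variable {g : ℝ → ℝ}

lemma integral_deriv (hg : IsCircleLift g) : ∫ y in 0..2 * π, deriv g y = 2 * π := by
  rw [intervalIntegral.integral_deriv_eq_sub (fun y _ => hg.differentiable y)
    (hg.continuous_deriv.intervalIntegrable _ _), ← zero_add (2 * π), hg.add_two_pi]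
  ring

lemma continuous_energyDensity (hg : IsCircleLift g) :
    Continuous (energyDensity g) := by
  have hpos := hg.deriv_pos
  have hcont := hg.continuous_deriv
  have hcont' := hg.continuous_deriv_deriv
  exact ((hcont'.pow 2).div (by fun_prop) fun y => (mul_pos four_pos (pow_pos (hpos y) 3)).ne').sub
    (continuous_const.div hcont fun y => (hpos y).ne')

lemma periodic_energyDensity (hg : IsCircleLift g) :
    Function.Periodic (energyDensity g) (2 * π) := fun y => by
  simp only [energyDensity, hg.periodic_deriv y, _root_.periodic_deriv hg.periodic_deriv y]

lemma deriv_halfDensity_sq_sub_sq_add (hg : IsCircleLift g) (y : ℝ) :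
    (deriv (halfDensity cos g) y ^ 2 - halfDensity cos g y ^ 2) +
        (deriv (halfDensity sin g) y ^ 2 - halfDensity sin g y ^ 2) =
      energyDensity g y + deriv g y := by
  rw [energyDensity, (hasDerivAt_halfDensity hg (hasDerivAt_cos _)).deriv,
    (hasDerivAt_halfDensity hg (hasDerivAt_sin _)).deriv, halfDensity, halfDensity]
  obtain ⟨r, hr, hry⟩ : ∃ r, 0 < r ∧ deriv g y = r ^ 2 :=
    ⟨√(deriv g y), sqrt_pos.2 (hg.deriv_pos y), (sq_sqrt (hg.deriv_pos y).le).symm⟩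
  rw [hry, sqrt_sq hr.le]
  field_simp
  linear_combination
    (16 * r ^ 8 + 4 * deriv (deriv g) y ^ 2 - 16 * r ^ 4) * sin_sq_add_cos_sq (g y)

lemma liftEnergy_eq_wirtingerDefect_add (hg : IsCircleLift g) : liftEnergy g =
    wirtingerDefect (halfDensity cos g) 0 (2 * π)
      + wirtingerDefect (halfDensity sin g) 0 (2 * π) := by
  have hcos : ContDiff ℝ 1 (halfDensity cos g) :=
    (contDiff_halfDensity hg contDiff_cos).of_le (by simp)
  have hsin : ContDiff ℝ 1 (halfDensity sin g) :=
    (contDiff_halfDensity hg contDiff_sin).of_le (by simp)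
  rw [wirtingerDefect, wirtingerDefect, ← intervalIntegral.integral_add
    ((continuous_deriv_sq_sub_sq hcos).intervalIntegrable _ _)
    ((continuous_deriv_sq_sub_sq hsin).intervalIntegrable _ _)]
  simp_rw [hg.deriv_halfDensity_sq_sub_sq_add]
  rw [intervalIntegral.integral_add (hg.continuous_energyDensity.intervalIntegrable _ _)
    (hg.continuous_deriv.intervalIntegrable _ _), hg.integral_deriv, liftEnergy]

lemma wirtingerDefect_halfDensity_cos_nonneg (hg : IsCircleLift g) (hb : IsBalanced g) :
    0 ≤ wirtingerDefect (halfDensity cos g) 0 (2 * π) := by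
  simpa only [sub_zero] using wirtingerDefect_halfDensity_nonneg hg hb 0

lemma wirtingerDefect_halfDensity_sin_nonneg (hg : IsCircleLift g) (hb : IsBalanced g) :
    0 ≤ wirtingerDefect (halfDensity sin g) 0 (2 * π) := by
  simpa only [cos_sub_pi_div_two] using wirtingerDefect_halfDensity_nonneg hg hb (π / 2)

lemma liftEnergy_nonneg (hg : IsCircleLift g) (hb : IsBalanced g) : 0 ≤ liftEnergy g := by
  rw [hg.liftEnergy_eq_wirtingerDefect_add]
  exact add_nonneg (hg.wirtingerDefect_halfDensity_cos_nonneg hb)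
    (hg.wirtingerDefect_halfDensity_sin_nonneg hb)

lemma liftEnergy_eq_zero_iff_halfDensity (hg : IsCircleLift g) (hb : IsBalanced g) :
    liftEnergy g = 0 ↔
      (∃ a b, ∀ y, halfDensity cos g y = a * cos y + b * sin y) ∧
      ∃ c d, ∀ y, halfDensity sin g y = c * cos y + d * sin y := by
  rw [hg.liftEnergy_eq_wirtingerDefect_add]
  constructor
  · intro h
    rw [add_eq_zero_iff_of_nonneg (hg.wirtingerDefect_halfDensity_cos_nonneg hb)
      (hg.wirtingerDefect_halfDensity_sin_nonneg hb)] at h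
    constructor
    · simpa only [sub_zero] using halfDensity_eq_cos_add_sin (c := 0) hg hb
        (by simpa only [sub_zero] using h.1)
    · simpa only [cos_sub_pi_div_two] using halfDensity_eq_cos_add_sin (c := π / 2) hg hb
        (by simpa only [cos_sub_pi_div_two] using h.2)
  · rintro ⟨⟨a, b, hcos⟩, c, d, hsin⟩
    have htrig := fun u v => wirtingerDefect_cos_add_sin u v 0
    simp only [sub_zero] at htrig
    rw [funext hcos, funext hsin, htrig, htrig, add_zero]

end IsCircleLift

/-! ### Möbius transformations of the circle -/

section Moebius

variable {A : Matrix.SpecialLinearGroup (Fin 2) ℝ} {α β : ℝ → ℝ}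

lemma norm_circlePoint (x : ℝ) : ‖circlePoint x‖ = 1 := by
  simp [circlePoint, EuclideanSpace.norm_eq]

lemma eq_inv_norm_smul_iff {E : Type*} [NormedAddCommGroup E] [NormedSpace ℝ E] {u v : E}
    (hu : ‖u‖ = 1) : u = ‖v‖⁻¹ • v ↔ ∃ r : ℝ, 0 < r ∧ r • u = v := by
  constructor
  · intro h
    have hv : ‖v‖ ≠ 0 := fun h0 => by
      rw [h, h0, inv_zero, zero_smul, norm_zero] at hu
      exact zero_ne_one hu
    exact ⟨‖v‖, (norm_nonneg v).lt_of_ne' hv, by rw [h, smul_inv_smul₀ hv]⟩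
  · rintro ⟨r, hr, rfl⟩
    rw [norm_smul, hu, mul_one, norm_of_nonneg hr.le, inv_smul_smul₀ hr.ne']

lemma eq_moebius_iff {u p : Plane} (hu : ‖u‖ = 1) :
    u = moebius A p ↔ ∃ r : ℝ, 0 < r ∧ r • u = Matrix.toEuclideanLin A.1 p :=
  eq_inv_norm_smul_iff hu

lemma circlePoint_eq_moebius_iff {x y : ℝ} :
    circlePoint x = moebius A (circlePoint y) ↔ ∃ r : ℝ, 0 < r ∧
      r * cos x = A.1 0 0 * cos y + A.1 0 1 * sin y ∧
      r * sin x = A.1 1 0 * cos y + A.1 1 1 * sin y := by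
  rw [eq_moebius_iff (norm_circlePoint x)]
  refine exists_congr fun r => and_congr_right fun _ => ?_
  rw [PiLp.ext_iff, Fin.forall_fin_two]
  simp [circlePoint]

/-- The angles `α t` and `β t` correspond under a fixed Möbius transformation of the circle; for
the tangent angle and the normalized arc length this characterizes the ovals. -/
def MoebiusRelated (α β : ℝ → ℝ) : Prop :=
  ∃ A : Matrix.SpecialLinearGroup (Fin 2) ℝ, ∀ t, circlePoint (α t) = moebius A (circlePoint (β t))

lemma MoebiusRelated.symm (h : MoebiusRelated α β) : MoebiusRelated β α := by
  obtain ⟨A, hA⟩ := h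
  refine ⟨A⁻¹, fun t => ?_⟩
  obtain ⟨r, hr, h⟩ := (eq_moebius_iff (norm_circlePoint _)).1 (hA t)
  refine (eq_moebius_iff (norm_circlePoint _)).2 ⟨r⁻¹, inv_pos.2 hr, ?_⟩
  rw [inv_smul_eq_iff₀ hr.ne', ← map_smul, h, ← LinearMap.comp_apply, ← Matrix.toLpLin_mul_same,
    ← Matrix.SpecialLinearGroup.coe_mul, inv_mul_cancel]
  simp

lemma moebiusRelated_comm : MoebiusRelated α β ↔ MoebiusRelated β α :=
  ⟨MoebiusRelated.symm, MoebiusRelated.symm⟩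

lemma moebiusRelated_comp_iff {γ : ℝ → ℝ} (hγ : Function.Surjective γ) :
    MoebiusRelated (α ∘ γ) (β ∘ γ) ↔ MoebiusRelated α β :=
  exists_congr fun A =>
    (hγ.forall (p := fun y => circlePoint (α y) = moebius A (circlePoint (β y)))).symm

lemma norm_standardTangent (p : Plane) : ‖standardTangent p‖ = ‖p‖ := by
  simp [standardTangent, EuclideanSpace.norm_eq, add_comm]

/-- The quarter turn, which acts on the circle as `standardTangent`. -/
noncomputable def quarterTurn : Matrix.SpecialLinearGroup (Fin 2) ℝ :=
  ⟨!![0, -1; 1, 0], by simp [Matrix.det_fin_two_of]⟩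

lemma toEuclideanLin_quarterTurn_mul (A : Matrix.SpecialLinearGroup (Fin 2) ℝ) (p : Plane) :
    Matrix.toEuclideanLin (quarterTurn * A).1 p =
      standardTangent (Matrix.toEuclideanLin A.1 p) := by
  rw [Matrix.SpecialLinearGroup.coe_mul, Matrix.toLpLin_mul_same, LinearMap.comp_apply]
  ext i
  fin_cases i <;> simp [quarterTurn, standardTangent, Matrix.vecHead, Matrix.vecTail]

lemma standardTangent_moebius (A : Matrix.SpecialLinearGroup (Fin 2) ℝ) (p : Plane) :
    standardTangent (moebius A p) = moebius (quarterTurn * A) p := by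
  have hsmul : ∀ (r : ℝ) (q : Plane), standardTangent (r • q) = r • standardTangent q :=
    fun r q => by
      ext i
      fin_cases i <;> simp [standardTangent]
  rw [moebius, moebius, hsmul, toEuclideanLin_quarterTurn_mul, norm_standardTangent]

variable {g ρ : ℝ → ℝ} {a b c d : ℝ}

/- Both sides are the Wronskian of `ρ cos g` and `ρ sin g`; comparing through the identity
`(ρ cos g) sin g = (ρ sin g) cos g` avoids differentiating `ρ`. -/
lemma det_eq_sq_mul_deriv (hg : Differentiable ℝ g)
    (hcos : ∀ y, ρ y * cos (g y) = a * cos y + b * sin y)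
    (hsin : ∀ y, ρ y * sin (g y) = c * cos y + d * sin y) (y : ℝ) :
    a * d - b * c = ρ y ^ 2 * deriv g y := by
  have hlin : ∀ u v, HasDerivAt (fun y => u * cos y + v * sin y) (v * cos y - u * sin y) y :=
    fun u v => by simpa only [sub_zero] using hasDerivAt_cos_add_sin u v 0 y
  have hgy := (hg y).hasDerivAt
  have hparallel : HasDerivAt (fun y => (a * cos y + b * sin y) * sin (g y)
      - (c * cos y + d * sin y) * cos (g y)) 0 y :=
    (hasDerivAt_const y 0).congr_of_eventuallyEq (.of_forall fun y => by
      simp only [← hcos, ← hsin]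
      ring)
  have hwronskian := hparallel.unique (((hlin a b).mul hgy.sin).sub ((hlin c d).mul hgy.cos))
  rw [← hcos, ← hsin] at hwronskian
  linear_combination ρ y * hwronskian + (b * cos y - a * sin y) * hsin y
    - (d * cos y - c * sin y) * hcos y - (a * d - b * c) * sin_sq_add_cos_sq y
    + ρ y ^ 2 * deriv g y * sin_sq_add_cos_sq (g y)

lemma IsCircleLift.moebiusRelated_id_iff (hg : IsCircleLift g) :
    MoebiusRelated g id ↔
      (∃ a b, ∀ y, halfDensity cos g y = a * cos y + b * sin y) ∧
      ∃ c d, ∀ y, halfDensity sin g y = c * cos y + d * sin y := by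
  simp only [MoebiusRelated, circlePoint_eq_moebius_iff, id]
  constructor
  · rintro ⟨A, hA⟩
    choose ρ hρ hcos hsin using hA
    have hsqrt : ∀ y, √(deriv g y) = (ρ y)⁻¹ := fun y => by
      have hdet := A.det_coe
      rw [Matrix.det_fin_two, det_eq_sq_mul_deriv hg.differentiable hcos hsin y] at hdet
      rw [eq_inv_of_mul_eq_one_right hdet, ← inv_pow, sqrt_sq (inv_pos.2 (hρ y)).le]
    exact ⟨⟨_, _, fun y => by rw [halfDensity, hsqrt, div_inv_eq_mul, mul_comm, hcos]⟩,
      _, _, fun y => by rw [halfDensity, hsqrt, div_inv_eq_mul, mul_comm, hsin]⟩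
  · rintro ⟨⟨a, b, hcos⟩, c, d, hsin⟩
    simp only [halfDensity, div_eq_inv_mul] at hcos hsin
    have hdet : Matrix.det !![a, b; c, d] = 1 := by
      rw [Matrix.det_fin_two_of, det_eq_sq_mul_deriv hg.differentiable hcos hsin 0, inv_pow,
        sq_sqrt (hg.deriv_pos 0).le, inv_mul_cancel₀ (hg.deriv_pos 0).ne']
    exact ⟨⟨!![a, b; c, d], hdet⟩, fun y =>
      ⟨_, inv_pos.2 (sqrt_pos.2 (hg.deriv_pos y)), by simpa using hcos y, by simpa using hsin y⟩⟩

end Moebius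

lemma IsCircleLift.liftEnergy_eq_zero_iff {g : ℝ → ℝ} (hg : IsCircleLift g) (hb : IsBalanced g) :
    liftEnergy g = 0 ↔ MoebiusRelated g id := by
  rw [hg.liftEnergy_eq_zero_iff_halfDensity hb, hg.moebiusRelated_id_iff]

/-! ### Strictly convex curves -/

namespace SmoothClosedCurve

section ArcLength

variable (σ : SmoothClosedCurve)

lemma contDiff_deriv : ContDiff ℝ ∞ (deriv σ.toFun) :=
  (contDiff_infty_iff_deriv.1 σ.smooth).2

lemma speed_pos (t : ℝ) : 0 < σ.speed t :=
  norm_pos_iff.2 (σ.immersion t)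

lemma contDiff_speed : ContDiff ℝ ∞ σ.speed :=
  σ.contDiff_deriv.norm ℝ σ.immersion

lemma continuous_speed : Continuous σ.speed :=
  σ.contDiff_speed.continuous

lemma periodic_speed : Function.Periodic σ.speed (2 * π) :=
  (_root_.periodic_deriv σ.periodic).comp norm

lemma hasDerivAt_arcLength (t : ℝ) : HasDerivAt σ.arcLength (σ.speed t) t :=
  (σ.continuous_speed.integral_hasStrictDerivAt 0 t).hasDerivAt

lemma arcLength_add_two_pi (t : ℝ) : σ.arcLength (t + 2 * π) = σ.arcLength t + σ.length := by
  have hint := fun a b => σ.continuous_speed.intervalIntegrable (μ := MeasureTheory.volume) a b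
  rw [length, arcLength, arcLength, arcLength,
    ← intervalIntegral.integral_add_adjacent_intervals (hint 0 t) (hint t (t + 2 * π)),
    σ.periodic_speed.intervalIntegral_add_eq t 0, zero_add]

lemma length_pos : 0 < σ.length :=
  intervalIntegral.intervalIntegral_pos_of_pos_on (σ.continuous_speed.intervalIntegrable _ _)
    (fun t _ => σ.speed_pos t) two_pi_pos

lemma two_pi_div_length_pos : 0 < 2 * π / σ.length :=
  div_pos two_pi_pos σ.length_pos

/-- The arc length parameter rescaled to total length `2π`, that is, the parameter of the
constant-speed parametrization by the circle. -/
noncomputable def normalizedArcLength (t : ℝ) : ℝ := 2 * π * σ.arcLength t / σ.length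

lemma hasDerivAt_normalizedArcLength (t : ℝ) :
    HasDerivAt σ.normalizedArcLength (2 * π / σ.length * σ.speed t) t :=
  (((σ.hasDerivAt_arcLength t).const_mul (2 * π)).div_const σ.length).congr_deriv (by ring)

lemma isCircleLift_normalizedArcLength : IsCircleLift σ.normalizedArcLength where
  smooth := by
    refine contDiff_infty_iff_deriv.2
      ⟨fun t => (σ.hasDerivAt_normalizedArcLength t).differentiableAt, ?_⟩
    rw [funext fun t => (σ.hasDerivAt_normalizedArcLength t).deriv]
    exact contDiff_const.mul σ.contDiff_speed
  deriv_pos t := by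
    rw [(σ.hasDerivAt_normalizedArcLength t).deriv]
    exact mul_pos σ.two_pi_div_length_pos (σ.speed_pos t)
  add_two_pi t := by
    rw [normalizedArcLength, normalizedArcLength, arcLength_add_two_pi, mul_add, add_div,
      mul_div_cancel_right₀ _ σ.length_pos.ne']

end ArcLength

variable {σ : SmoothClosedCurve} {α ϑ : ℝ → ℝ}

section Calculus

lemma grad_comp {f : ℝ → ℝ} {t : ℝ} (hf : DifferentiableAt ℝ f (α t))
    (hα : DifferentiableAt ℝ α t) :
    σ.grad (f ∘ α) t = deriv f (α t) * σ.grad α t := by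
  rw [grad, grad, deriv_comp t hf hα, mul_div_assoc]

lemma grad_normalizedArcLength (t : ℝ) :
    σ.grad σ.normalizedArcLength t = 2 * π / σ.length := by
  rw [grad, (σ.hasDerivAt_normalizedArcLength t).deriv, mul_div_cancel_right₀ _ (σ.speed_pos t).ne']

lemma integral_comp_mul_grad {F : ℝ → ℝ} (hα : IsCircleLift α) (hF : Continuous F)
    (hper : Function.Periodic F (2 * π)) :
    σ.integral (fun t => F (α t) * σ.grad α t) = ∫ y in 0..2 * π, F y := by
  rw [← hα.integral_comp_mul_deriv hF hper]
  refine intervalIntegral.integral_congr fun t _ => ?_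
  simp only [grad]
  rw [mul_assoc, div_mul_cancel₀ _ (σ.speed_pos t).ne']

lemma integral_comp_normalizedArcLength {F : ℝ → ℝ} (hF : Continuous F)
    (hper : Function.Periodic F (2 * π)) :
    2 * π / σ.length * σ.integral (F ∘ σ.normalizedArcLength) = ∫ y in 0..2 * π, F y := by
  rw [← integral_comp_mul_grad (σ := σ) σ.isCircleLift_normalizedArcLength hF hper]
  simp only [integral, grad_normalizedArcLength, mul_comm _ (2 * π / σ.length), mul_assoc,
    intervalIntegral.integral_const_mul, Function.comp_apply]

end Calculus

/-- The function `ϑ` is a tangent angle of `σ`: a lift of the unit tangent map, viewed as an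
orientation-preserving diffeomorphism of the circle. -/
structure IsTangentAngle (σ : SmoothClosedCurve) (ϑ : ℝ → ℝ) : Prop extends IsCircleLift ϑ where
  unitTangent_eq : ∀ t, σ.unitTangent t = circlePoint (ϑ t)

lemma StrictlyConvex.exists_isTangentAngle (hσ : σ.StrictlyConvex) :
    ∃ ϑ, σ.IsTangentAngle ϑ := by
  obtain ⟨ϑ, η, hϑ, hη, hleft, -, hadd, htangent⟩ := hσ
  have hmono : Monotone ϑ := by
    refine (hϑ.continuous.strictMono_of_inj hleft.injective).elim StrictMono.monotone
      fun hanti => ?_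
    have h := hanti two_pi_pos
    rw [← zero_add (2 * π), hadd 0] at h
    exact absurd h (by linarith [two_pi_pos])
  refine ⟨ϑ, ⟨hϑ, fun t => (hmono.deriv_nonneg).lt_of_ne' fun h0 => ?_, hadd⟩, htangent⟩
  have hid := (hη.differentiable (by simp) (ϑ t)).hasDerivAt.comp t
    (hϑ.differentiable (by simp) t).hasDerivAt
  rw [hleft.comp_eq_id, h0, mul_zero] at hid
  exact zero_ne_one (hid.unique (hasDerivAt_id t))

namespace IsTangentAngle

lemma deriv_eq (hϑ : σ.IsTangentAngle ϑ) (t : ℝ) :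
    deriv σ.toFun t = σ.speed t • circlePoint (ϑ t) := by
  rw [← hϑ.unitTangent_eq, unitTangent, smul_inv_smul₀ (σ.speed_pos t).ne']

lemma deriv_apply_zero (hϑ : σ.IsTangentAngle ϑ) (t : ℝ) :
    deriv σ.toFun t 0 = σ.speed t * cos (ϑ t) := by
  simp [hϑ.deriv_eq, circlePoint]

lemma deriv_apply_one (hϑ : σ.IsTangentAngle ϑ) (t : ℝ) :
    deriv σ.toFun t 1 = σ.speed t * sin (ϑ t) := by
  simp [hϑ.deriv_eq, circlePoint]

end IsTangentAngle

lemma IsTangentAngle.curvature_eq_grad (hϑ : σ.IsTangentAngle ϑ) (t : ℝ) :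
    σ.curvature t = σ.grad ϑ t := by
  have hspeed := (σ.contDiff_speed.differentiable (by simp) t).hasDerivAt
  have hangle := (hϑ.differentiable t).hasDerivAt
  have hdd := (σ.contDiff_deriv.differentiable (by simp) t).hasDerivAt
  have hx := hasDerivAt_euclideanSpace_apply hdd 0
  have hy := hasDerivAt_euclideanSpace_apply hdd 1
  rw [funext hϑ.deriv_apply_zero] at hx
  rw [funext hϑ.deriv_apply_one] at hy
  rw [curvature, grad, hx.unique (hspeed.mul hangle.cos), hy.unique (hspeed.mul hangle.sin),
    hϑ.deriv_apply_zero, hϑ.deriv_apply_one,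
    div_eq_div_iff (pow_pos (σ.speed_pos t) 3).ne' (σ.speed_pos t).ne']
  linear_combination σ.speed t ^ 3 * deriv ϑ t * sin_sq_add_cos_sq (ϑ t)

lemma integral_deriv_apply (i : Fin 2) : ∫ t in 0..2 * π, deriv σ.toFun t i = 0 := by
  have hderiv : ∀ t, HasDerivAt (fun t => σ.toFun t i) (deriv σ.toFun t i) t :=
    fun t => hasDerivAt_euclideanSpace_apply (σ.smooth.differentiable (by simp) t).hasDerivAt i
  have hcont : Continuous fun t => deriv σ.toFun t i :=
    (EuclideanSpace.proj (𝕜 := ℝ) i : Plane →L[ℝ] ℝ).continuous.comp σ.contDiff_deriv.continuous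
  rw [intervalIntegral.integral_eq_sub_of_hasDerivAt (fun t _ => hderiv t)
    (hcont.intervalIntegrable _ _), ← zero_add (2 * π), σ.periodic 0, sub_self]

namespace IsTangentAngle

variable {g h : ℝ → ℝ}

lemma integral_cos (hϑ : σ.IsTangentAngle ϑ) : σ.integral (fun t => cos (ϑ t)) = 0 := by
  simp_rw [integral, mul_comm (cos _), ← hϑ.deriv_apply_zero, integral_deriv_apply]

lemma integral_sin (hϑ : σ.IsTangentAngle ϑ) : σ.integral (fun t => sin (ϑ t)) = 0 := by
  simp_rw [integral, mul_comm (sin _), ← hϑ.deriv_apply_one, integral_deriv_apply]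

lemma isBalanced (hϑ : σ.IsTangentAngle ϑ) (hg : IsCircleLift g)
    (hgl : g ∘ σ.normalizedArcLength = ϑ) : IsBalanced g := by
  have hzero : ∀ F : ℝ → ℝ, Continuous F → Function.Periodic F (2 * π) →
      σ.integral (F ∘ ϑ) = 0 → ∫ y in 0..2 * π, F (g y) = 0 := fun F hF hper h => by
    rw [← hgl, ← Function.comp_assoc] at h
    exact (integral_comp_normalizedArcLength (hF.comp hg.continuous)
      (hg.periodic_comp hper)).symm.trans (by rw [h, mul_zero])
  exact isBalanced_of_integral_cos_sin hg (hzero cos continuous_cos cos_periodic hϑ.integral_cos)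
    (hzero sin continuous_sin sin_periodic hϑ.integral_sin)

lemma energyG_eq_liftEnergy (hϑ : σ.IsTangentAngle ϑ) (hg : IsCircleLift g)
    (hgl : g ∘ σ.normalizedArcLength = ϑ) : σ.energyG = liftEnergy g := by
  have hl := σ.isCircleLift_normalizedArcLength
  have hcurv : σ.curvature = (fun y => 2 * π / σ.length * deriv g y) ∘ σ.normalizedArcLength :=
    funext fun t => by
      rw [hϑ.curvature_eq_grad, ← hgl, grad_comp (hg.differentiable _) (hl.differentiable t),
        grad_normalizedArcLength, mul_comm, Function.comp_apply]
  have hgrad : ∀ t, σ.grad σ.curvature t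
      = (2 * π / σ.length) ^ 2 * deriv (deriv g) (σ.normalizedArcLength t) := fun t => by
    rw [hcurv, grad_comp ((hg.differentiable_deriv _).const_mul _) (hl.differentiable t),
      deriv_const_mul_field, grad_normalizedArcLength]
    ring
  rw [energyG, liftEnergy, ← integral_comp_mul_grad hl hg.continuous_energyDensity
    hg.periodic_energyDensity]
  congr 2
  funext t
  have hpos := hg.deriv_pos (σ.normalizedArcLength t)
  have hL := σ.length_pos
  rw [hgrad, hcurv, grad_normalizedArcLength, energyDensity, Function.comp_apply]
  field_simp

lemma energyGStar_eq_liftEnergy (hϑ : σ.IsTangentAngle ϑ) (hh : IsCircleLift h)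
    (hhϑ : h ∘ ϑ = σ.normalizedArcLength) :
    σ.energyGStar = 2 * π / σ.length * liftEnergy h := by
  have hcurv : σ.curvature = (fun y => 2 * π / σ.length / deriv h y) ∘ ϑ := funext fun t => by
    rw [hϑ.curvature_eq_grad, ← grad_normalizedArcLength t, ← hhϑ,
      grad_comp (hh.differentiable _) (hϑ.differentiable t), Function.comp_apply,
      mul_div_cancel_left₀ _ (hh.deriv_pos _).ne']
  have hgrad : ∀ t, σ.grad σ.curvature t
      = -(2 * π / σ.length * deriv (deriv h) (ϑ t)) / deriv h (ϑ t) ^ 2 * σ.grad ϑ t := fun t => by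
    have hderiv : HasDerivAt (fun y => 2 * π / σ.length / deriv h y) _ (ϑ t) :=
      (hasDerivAt_const (ϑ t) (2 * π / σ.length)).div
      (hh.differentiable_deriv (ϑ t)).hasDerivAt (hh.deriv_pos (ϑ t)).ne'
    rw [hcurv, grad_comp hderiv.differentiableAt (hϑ.differentiable t), hderiv.deriv, zero_mul,
      zero_sub]
  have hdensity : ∀ t, σ.grad σ.curvature t ^ 2 / (4 * σ.curvature t ^ 2) - σ.curvature t ^ 2
      = 2 * π / σ.length * (energyDensity h (ϑ t) * σ.grad ϑ t) := fun t => by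
    have hpos := hh.deriv_pos (ϑ t)
    have hL := σ.length_pos
    rw [hgrad, ← hϑ.curvature_eq_grad, hcurv, energyDensity, Function.comp_apply]
    field_simp
  have hintegral := integral_comp_mul_grad (σ := σ) hϑ.toIsCircleLift hh.continuous_energyDensity
    hh.periodic_energyDensity
  rw [integral] at hintegral
  rw [energyGStar, liftEnergy, ← hintegral, integral]
  simp_rw [hdensity, mul_assoc (2 * π / σ.length), intervalIntegral.integral_const_mul]
  ring

lemma isOval_iff (hϑ : σ.IsTangentAngle ϑ) (hσ : σ.StrictlyConvex) :
    σ.IsOval ↔ MoebiusRelated ϑ σ.normalizedArcLength := by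
  constructor
  · rintro ⟨-, A, hA⟩
    refine ⟨quarterTurn * A, fun t => ?_⟩
    rw [← hϑ.unitTangent_eq, hA, standardTangent_moebius, normalizedArcLength]
  · rintro ⟨A, hA⟩
    refine ⟨hσ, quarterTurn⁻¹ * A, fun t => ?_⟩
    rw [standardTangent_moebius, mul_inv_cancel_left, hϑ.unitTangent_eq, hA, normalizedArcLength]

lemma isOval_iff_of_comp_normalizedArcLength (hϑ : σ.IsTangentAngle ϑ) (hσ : σ.StrictlyConvex)
    (hgl : g ∘ σ.normalizedArcLength = ϑ) : σ.IsOval ↔ MoebiusRelated g id := by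
  rw [hϑ.isOval_iff hσ, ← hgl]
  exact moebiusRelated_comp_iff (β := id) σ.isCircleLift_normalizedArcLength.surjective

lemma isOval_iff_of_comp_angle (hϑ : σ.IsTangentAngle ϑ) (hσ : σ.StrictlyConvex)
    (hhϑ : h ∘ ϑ = σ.normalizedArcLength) : σ.IsOval ↔ MoebiusRelated h id := by
  rw [hϑ.isOval_iff hσ, ← hhϑ, moebiusRelated_comm]
  exact moebiusRelated_comp_iff (β := id) hϑ.surjective

end IsTangentAngle

end SmoothClosedCurve

theorem theorem1 (σ : SmoothClosedCurve) (hσ : σ.StrictlyConvex) :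
    (0 ≤ σ.energyG ∧ (σ.energyG = 0 ↔ σ.IsOval)) ∧
    (0 ≤ σ.energyGStar ∧ (σ.energyGStar = 0 ↔ σ.IsOval)) := by
  obtain ⟨ϑ, hϑ⟩ := hσ.exists_isTangentAngle
  have hl := σ.isCircleLift_normalizedArcLength
  obtain ⟨μ, hμ, hμl, -⟩ := hl.exists_inverse
  have hg : IsCircleLift (ϑ ∘ μ) := hϑ.comp hμ
  have hgl : (ϑ ∘ μ) ∘ σ.normalizedArcLength = ϑ := funext fun t => congrArg ϑ (hμl t)
  obtain ⟨h, hh, hleft, hright⟩ := hg.exists_inverse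
  have hhϑ : h ∘ ϑ = σ.normalizedArcLength := by
    rw [← hgl, ← Function.comp_assoc, hleft.comp_eq_id, Function.id_comp]
  have hbal := hϑ.isBalanced hg hgl
  have hbal' := hbal.of_inverse hg hh hleft hright
  have hc := σ.two_pi_div_length_pos
  rw [hϑ.energyG_eq_liftEnergy hg hgl, hϑ.energyGStar_eq_liftEnergy hh hhϑ,
    mul_eq_zero_iff_left hc.ne', hg.liftEnergy_eq_zero_iff hbal, hh.liftEnergy_eq_zero_iff hbal']
  exact ⟨⟨hg.liftEnergy_nonneg hbal, (hϑ.isOval_iff_of_comp_normalizedArcLength hσ hgl).symm⟩,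
    mul_nonneg hc.le (hh.liftEnergy_nonneg hbal'), (hϑ.isOval_iff_of_comp_angle hσ hhϑ).symm⟩
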